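/- Let $S_1,S_2\subseteq\mathbb N_0$ be nonempty. For $S\subseteq\mathbb N_0$ nonempty, the $S$-gap shift $\mathsf X(S)\subseteq\{0,1\}^{\mathbb Z}$ is the shift space with forbidden words $10^k1$ for $k\notin S$ if $S$ is infinite, and $10^k1$ for $k\notin S$, $k<\max S$, together with $0^{1+\max S}$, if $S$ is finite. A shift space is sofic if it is the set of label sequences of bi-infinite walks on a finite labeled directed graph. The suspension $SX$ of a shift space $X$ with shift map $\sigma$, $(\sigma x)_i=x_{i+1}$, is the quotient of $X\times\mathbb R$ by the equivalence relation generated by $(x,t+1)\sim(\sigma x,t)$. Two shift spaces $X,Y$ are flow equivalent if there is a homeomorphism $\Phi\colon SX\to SY$ such that for each $[x,t]\in SX$ there is a monotonically increasing $\phi\colon\mathbb R\to\mathbb R$ such that $\Phi([x,t])=[y,t']$ implies $\Phi([x,t+r])=[y,t'+\phi(r)]$ for all $r\in\mathbb R$. An expression $S=R\cup(T+N\mathbb N_0)$ with $R,T\subseteq\mathbb N_0$ finite and $N\ge 1$ is of minimal form if $N$ is the least modulus possible in any expression of $S$ of this kind, $R\cap(T+N\mathbb N_0)=\emptyset$, and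 $|t-t'|<N$ for all $t,t'\in T$. Suppose that $\mathsf X(S_1)$ and $\mathsf X(S_2)$ are sofic, and let $S_1=R_1\cup(T_1+N\mathbb N_0)$ and $S_2=R_2\cup(T_2+M\mathbb N_0)$ be of minimal form. If $\mathsf X(S_1)$ and $\mathsf X(S_2)$ are flow equivalent, then $N=M$. If moreover $S_1$ and $S_2$ are both infinite or both finite (that is, $T_1$ and $T_2$ are both nonempty or both empty), then there is an integer $r$ such that $r+T_1\equiv T_2\pmod N$, meaning that the sets $r+T_1$ and $T_2$ have the same set of residues modulo $N$. -/

import Mathlib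

open SymbolicDynamics.FullShift

namespace FlowEq

/-- The word `w`, as a finite pattern on `ℤ` occupying the positions `0, …, |w| - 1`. -/
noncomputable def wordPattern {A : Type*} [Inhabited A] (w : List A) : Pattern A ℤ where
  config g := if 0 ≤ g then w.getD g.toNat default else default
  support := Finset.Ico 0 (w.length : ℤ)
  condition g hg := by
    simp only [Finset.mem_Ico, not_and, not_lt] at hg
    split_ifs with h
    · exact List.getD_eq_default _ _ (by have := hg h; omega)
    · rfl

/-- The forbidden words of the `S`-gap shift: the words `1 0^k 1` with `k ∉ S` (only those with
`k < max S` when `S` is finite), and, when `S` is finite, the word `0^(1 + max S)`.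
For finite nonempty `S : Set ℕ`, `sSup S` is the maximum of `S`. -/
def gapForbidden (S : Set ℕ) : Set (List (Fin 2)) :=
  {w | ∃ k, k ∉ S ∧ (S.Finite → k < sSup S) ∧ w = 1 :: (List.replicate k 0 ++ [1])} ∪
    {w | S.Finite ∧ w = List.replicate (1 + sSup S) 0}

/-- The `S`-gap shift `X(S)`, a subshift of `{0,1}^ℤ`. -/
noncomputable def gapShift (S : Set ℕ) : Subshift (Fin 2) ℤ :=
  Subshift.ofForbidden (wordPattern '' gapForbidden S)

/-- A shift space is sofic if it is the set of label sequences of the bi-infinite walks on a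
finite directed graph (vertices `V`, edges `E`, source `s`, target `t`) with edge labelling `L`. -/
def IsSofic {A : Type*} [TopologicalSpace A] (X : Subshift A ℤ) : Prop :=
  ∃ (V E : Type) (_ : Finite V) (_ : Finite E) (s t : E → V) (L : E → A),
    X.carrier = {x | ∃ e : ℤ → E, (∀ i, t (e i) = s (e (i + 1))) ∧ ∀ i, x i = L (e i)}

/-- The relation `(x, t + 1) ∼ (σ x, t)` on `X × ℝ`, where `(σ x) i = x (1 + i)`. -/
def SuspRel {A : Type*} [TopologicalSpace A] (X : Subshift A ℤ) (p q : X.carrier × ℝ) : Prop :=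
  (q.1 : ℤ → A) = shift 1 (p.1 : ℤ → A) ∧ p.2 = q.2 + 1

/-- The suspension `SX`: the quotient of `X × ℝ` by the equivalence relation generated by
`(x, t + 1) ∼ (σ x, t)`. -/
def Suspension {A : Type*} [TopologicalSpace A] (X : Subshift A ℤ) : Type _ :=
  Quot (SuspRel X)

/-- The suspension carries the quotient of the product topology. -/
instance {A : Type*} [TopologicalSpace A] (X : Subshift A ℤ) : TopologicalSpace (Suspension X) :=
  inferInstanceAs (TopologicalSpace (Quot (SuspRel X)))

/-- The class `[x, t]` in the suspension. -/
def Suspension.mk {A : Type*} [TopologicalSpace A] {X : Subshift A ℤ} (x : X.carrier) (t : ℝ) :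
    Suspension X :=
  Quot.mk _ (x, t)

/-- Flow equivalence: a homeomorphism between the suspensions which carries flow lines to flow
lines and preserves their direction. -/
def FlowEquivalent {A B : Type*} [TopologicalSpace A] [TopologicalSpace B]
    (X : Subshift A ℤ) (Y : Subshift B ℤ) : Prop :=
  ∃ Φ : Suspension X ≃ₜ Suspension Y, ∀ (x : X.carrier) (t : ℝ), ∃ φ : ℝ → ℝ, Monotone φ ∧
    ∀ (y : Y.carrier) (t' : ℝ), Φ (Suspension.mk x t) = Suspension.mk y t' →
      ∀ r : ℝ, Φ (Suspension.mk x (t + r)) = Suspension.mk y (t' + φ r)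

/-- The set `T + N ℕ₀`. -/
def progressions (T : Finset ℕ) (N : ℕ) : Set ℕ :=
  {n | ∃ t ∈ T, ∃ k : ℕ, n = t + N * k}

/-- `S = R ∪ (T + N ℕ₀)`, with `R`, `T` finite and `N ≥ 1`, is a representation of `S` in minimal
form: `N` is the least possible modulus of such a representation of `S`, the two parts are
disjoint, and any two elements of `T` differ by less than `N`. -/
structure IsMinimalForm (S : Set ℕ) (R T : Finset ℕ) (N : ℕ) : Prop where
  pos : 0 < N
  eq : S = ↑R ∪ progressions T N
  minimal : ∀ (R' T' : Finset ℕ) (N' : ℕ), 0 < N' → S = ↑R' ∪ progressions T' N' → N ≤ N'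
  disjoint : Disjoint (R : Set ℕ) (progressions T N)
  diff_lt : ∀ t ∈ T, ∀ t' ∈ T, |(t : ℤ) - (t' : ℤ)| < (N : ℤ)

end FlowEq

/-! A flow equivalence lifts to products with the line: `X` is profinite and `ℝ` contractible, so
the time coordinate lifts from the circle. This gives continuous maps `F`, `G` sending orbits to
orbits, with integer cocycles and inverse up to displacement along orbits
(`FlowEquivalent.exists_cocycleMaps`). Everything is read off from the points `0^∞`, `0^∞ 1 0^∞` and
`0^∞ 1 0^n 1 0^∞`, the last being two overlapping copies of the second. Cocycle maps carry such
gluings to gluings, with controlled displacement (`CocycleMap.exists_isGlued`).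

If both sets are infinite and `F` fixes `0^∞`, both cocycles equal `1` there. The image of `0^∞ 1
0^∞` has a first and a last `1`, so a large gap `n` of `S₁` produces a gap `n + c` of `S₂`, and
symmetrically (`exists_add_mem_of_map_zeroPt`). Hence the two sets are eventually translates of each
other, which gives the modulus and the residues.

Otherwise both moduli are `1`. For a finite set this is immediate. For `S₁` infinite, `0^∞` goes to
a periodic point `q` containing a `1`, and the image of `0^∞ 1 0^∞` is asymptotic to translates of
`q` on both sides. As `1` is synchronizing, two copies of that image can be glued at every large
displacement in one class modulo the period; pulled back by `G`, one period counts as one step, so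
every large gap occurs in `S₁` (`cofinite_of_map_zeroPt`). -/

namespace FlowEq

/-! ### Suspensions, and lifting flow equivalences to cocycle maps. -/

section Suspension

open Filter Topology

variable {A B : Type*} [TopologicalSpace A] [TopologicalSpace B]

/-- The `j`-th power of the shift map of a subshift. -/
def sh {X : Subshift A ℤ} (j : ℤ) (x : X.carrier) : X.carrier :=
  ⟨shift j (x : ℤ → A), X.mapsTo j x.2⟩

@[simp] lemma sh_apply {X : Subshift A ℤ} (j : ℤ) (x : X.carrier) (i : ℤ) :
    (sh j x : ℤ → A) i = (x : ℤ → A) (j + i) := rfl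

lemma ext_apply {X : Subshift A ℤ} {x y : X.carrier}
    (h : ∀ i, (x : ℤ → A) i = (y : ℤ → A) i) : x = y :=
  Subtype.ext (funext h)

@[simp] lemma sh_zero {X : Subshift A ℤ} (x : X.carrier) : sh 0 x = x :=
  ext_apply fun i => by simp

lemma sh_sh {X : Subshift A ℤ} (i j : ℤ) (x : X.carrier) : sh i (sh j x) = sh (j + i) x :=
  ext_apply fun k => by simp [add_assoc]

lemma continuous_sh {X : Subshift A ℤ} (j : ℤ) : Continuous (sh (X := X) j) :=
  ((continuous_shift j).comp continuous_subtype_val).subtype_mk _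

namespace Suspension

variable {X : Subshift A ℤ} {Y : Subshift B ℤ}

lemma mk_sh_natCast (x : X.carrier) (t : ℝ) (n : ℕ) : mk x (t + n) = mk (sh n x) t := by
  induction n generalizing t with
  | zero => simp
  | succ n ih =>
    have h : mk (sh n x) (t + 1) = mk (sh (n + 1 : ℕ) x) t :=
      Quot.sound ⟨funext fun i => by simp [add_assoc], rfl⟩
    rw [← h, ← ih]
    congr 1
    push_cast
    ring

lemma mk_add_intCast (x : X.carrier) (t : ℝ) (j : ℤ) : mk x (t + j) = mk (sh j x) t := by
  obtain ⟨n, rfl | rfl⟩ := j.eq_nat_or_neg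
  · exact_mod_cast mk_sh_natCast x t n
  · have h := mk_sh_natCast (sh (-n : ℤ) x) (t - n) n
    rw [sh_sh] at h
    simpa [sub_eq_add_neg] using h.symm

lemma mk_eq_mk_iff {x y : X.carrier} {t s : ℝ} :
    mk x t = mk y s ↔ ∃ j : ℤ, y = sh j x ∧ t = s + j := by
  constructor
  · intro h
    have key : ∀ p q : X.carrier × ℝ, Relation.EqvGen (SuspRel X) p q →
        ∃ j : ℤ, q.1 = sh j p.1 ∧ p.2 = q.2 + j := by
      intro p q hpq
      induction hpq with
      | rel p q h => exact ⟨1, Subtype.ext h.1, by simpa using h.2⟩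
      | refl p => exact ⟨0, by simp, by simp⟩
      | symm p q _ ih =>
        obtain ⟨j, h1, h2⟩ := ih
        exact ⟨-j, by rw [h1, sh_sh]; simp, by rw [h2]; push_cast; ring⟩
      | trans p q r _ _ ih1 ih2 =>
        obtain ⟨j, h1, h2⟩ := ih1
        obtain ⟨k, h3, h4⟩ := ih2
        exact ⟨j + k, by rw [h3, h1, sh_sh], by rw [h2, h4]; push_cast; ring⟩
    exact key _ _ (Quot.eqvGen_exact h)
  · rintro ⟨j, rfl, rfl⟩
    exact mk_add_intCast x s j

lemma continuous_mk : Continuous fun p : X.carrier × ℝ => mk p.1 p.2 :=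
  continuous_quot_mk

lemma exists_mk (q : Suspension X) : ∃ x t, q = mk x t := by
  obtain ⟨⟨x, t⟩, rfl⟩ := Quot.exists_rep q
  exact ⟨x, t, rfl⟩

lemma isOpenMap_mk : IsOpenMap fun p : X.carrier × ℝ => mk p.1 p.2 := by
  intro U hU
  have : (fun p : X.carrier × ℝ => mk p.1 p.2) ⁻¹' ((fun p : X.carrier × ℝ => mk p.1 p.2) '' U) =
      ⋃ j : ℤ, (fun p : X.carrier × ℝ => (sh j p.1, p.2 - j)) ⁻¹' U := by
    ext ⟨y, t⟩
    simp only [Set.mem_preimage, Set.mem_image, Prod.exists, Set.mem_iUnion]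
    constructor
    · rintro ⟨x, s, hU, h⟩
      obtain ⟨j, rfl, rfl⟩ := mk_eq_mk_iff.1 h.symm
      exact ⟨j, by simpa using hU⟩
    · rintro ⟨j, hj⟩
      exact ⟨_, _, hj, mk_eq_mk_iff.2 ⟨-j, by simp [sh_sh], by push_cast; ring⟩⟩
  refine isQuotientMap_quot_mk.isOpen_preimage.1 (show IsOpen (_ ⁻¹' _) from ?_)
  change IsOpen ((fun p : X.carrier × ℝ => mk p.1 p.2) ⁻¹' _)
  rw [this]
  refine isOpen_iUnion fun j => hU.preimage ?_
  exact ((continuous_sh j).comp continuous_fst).prodMk (continuous_snd.sub continuous_const)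

/-- The canonical map of the suspension onto the circle `ℝ / ℤ`. -/
def angle (q : Suspension X) : AddCircle (1 : ℝ) :=
  Quot.lift (fun p : X.carrier × ℝ => (p.2 : AddCircle (1 : ℝ)))
    (fun p q h => by
      rw [h.2, AddCircle.coe_add, AddCircle.coe_period, add_zero]) q

@[simp] lemma angle_mk (x : X.carrier) (t : ℝ) : angle (mk x t) = (t : AddCircle (1 : ℝ)) := rfl

lemma continuous_angle : Continuous (angle (X := X)) :=
  isQuotientMap_quot_mk.continuous_iff.2 ((AddCircle.continuous_mk' 1).comp continuous_snd)

end Suspension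

section CircleLift

variable {Z : Type*} [TopologicalSpace Z] [CompactSpace Z] [T2Space Z] [TotallyDisconnectedSpace Z]

/-- A circle-valued map on a profinite space lifts to the line. -/
lemma exists_lift_of_profinite {θ : Z → AddCircle (1 : ℝ)} (hθ : Continuous θ) :
    ∃ s : Z → ℝ, Continuous s ∧ ∀ z, (s z : AddCircle (1 : ℝ)) = θ z := by
  classical
  have hne : ((0 : ℝ) : AddCircle (1 : ℝ)) ≠ ((1 / 2 : ℝ) : AddCircle (1 : ℝ)) := fun h => by
    have := (AddCircle.coe_eq_coe_iff_of_mem_Ico (p := (1 : ℝ)) (a := 0) (x := 0) (y := 1 / 2)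
      (by norm_num) (by norm_num)).1 h
    norm_num at this
  -- On `C` the value `1/2` is avoided, off `C` the value `0`; each piece uses the branch of the
  -- logarithm cut at its avoided value.
  obtain ⟨C, hC, h0C, hC1⟩ := exists_clopen_of_closed_subset_open
    (Z := θ ⁻¹' {((0 : ℝ) : AddCircle (1 : ℝ))})
    (U := (θ ⁻¹' {((1 / 2 : ℝ) : AddCircle (1 : ℝ))})ᶜ)
    (isClosed_singleton.preimage hθ) (isClosed_singleton.preimage hθ).isOpen_compl
    (fun z hz hz' => hne (hz.symm.trans hz'))
  refine ⟨fun z => if z ∈ C then (AddCircle.equivIco 1 (1 / 2) (θ z) : ℝ)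
    else (AddCircle.equivIco 1 0 (θ z) : ℝ), continuous_iff_continuousAt.2 fun z => ?_,
    fun z => ?_⟩
  · by_cases hz : z ∈ C
    · have h1 := (continuousAt_subtype_val.comp
        (AddCircle.continuousAt_equivIco (1 : ℝ) (1 / 2) (hC1 hz))).comp hθ.continuousAt
      refine h1.congr ?_
      filter_upwards [hC.isOpen.mem_nhds hz] with w hw
      simp [hw]
    · have h1 := (continuousAt_subtype_val.comp
        (AddCircle.continuousAt_equivIco (1 : ℝ) 0 (fun h => hz (h0C h)))).comp hθ.continuousAt
      refine h1.congr ?_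
      filter_upwards [hC.compl.isOpen.mem_nhds hz] with w hw
      have hw' : w ∉ C := hw
      simp [hw']
  · dsimp only
    split_ifs
    · exact AddCircle.coe_equivIco
    · exact AddCircle.coe_equivIco

/-- A circle-valued map on the product of a profinite space and the line lifts to the line. -/
lemma exists_lift_of_profinite_prod {θ : Z × ℝ → AddCircle (1 : ℝ)} (hθ : Continuous θ) :
    ∃ s : Z × ℝ → ℝ, Continuous s ∧ ∀ q, (s q : AddCircle (1 : ℝ)) = θ q := by
  obtain ⟨s₀, hs₀, hs₀θ⟩ := exists_lift_of_profinite
    (θ := fun z => θ (z, 0)) (hθ.comp (by fun_prop))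
  -- Contract the line to `0`, and lift the homotopy starting from the lift `s₀` on `Z × {0}`.
  let H : C(unitInterval × (Z × ℝ), AddCircle (1 : ℝ)) :=
    ⟨fun q => θ (q.2.1, (q.1 : ℝ) * q.2.2), hθ.comp (by fun_prop)⟩
  let F : C(Z × ℝ, ℝ) := ⟨fun q => s₀ q.1, by fun_prop⟩
  have h0 : ∀ a, H (0, a) = ((F a : ℝ) : AddCircle (1 : ℝ)) := fun a => by simp [H, F, hs₀θ]
  let G := (AddCircle.isCoveringMap_coe (1 : ℝ)).liftHomotopy H F h0
  refine ⟨fun q => G (1, q), by fun_prop, fun q => ?_⟩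
  have := congr_fun ((AddCircle.isCoveringMap_coe (1 : ℝ)).liftHomotopy_lifts H F h0) (1, q)
  exact this.trans (by simp [H])

end CircleLift

instance [Finite A] [DiscreteTopology A] (X : Subshift A ℤ) : CompactSpace X.carrier :=
  isCompact_iff_compactSpace.1 X.isClosed.isCompact

lemma abs_sub_lt_one_of_int {s t : ℝ} {j : ℤ} (h : s = t + j) (hlt : |s - t| < 1) : j = 0 := by
  have : |(j : ℝ)| < 1 := by rwa [h, add_sub_cancel_left] at hlt
  exact Int.abs_lt_one_iff.1 (by exact_mod_cast this)

/-- A continuous map between suspensions lifts to the products with the line. -/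
theorem Suspension.exists_lift [Finite A] [DiscreteTopology A] [DiscreteTopology B]
    {X : Subshift A ℤ} {Y : Subshift B ℤ} {Ψ : Suspension X → Suspension Y} (hΨ : Continuous Ψ) :
    ∃ (f : X.carrier → Y.carrier) (s : X.carrier → ℝ → ℝ), Continuous f ∧
      Continuous (fun p : X.carrier × ℝ => s p.1 p.2) ∧
      ∀ x t, Ψ (mk x t) = mk (f x) (s x t) := by
  obtain ⟨s, hs, hsθ⟩ := exists_lift_of_profinite_prod
    (θ := fun p : X.carrier × ℝ => angle (Ψ (mk p.1 p.2)))
    (continuous_angle.comp (hΨ.comp continuous_mk))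
  have hex : ∀ p : X.carrier × ℝ, ∃ y, Ψ (mk p.1 p.2) = mk y (s p) := fun p => by
    obtain ⟨y, t, h⟩ := exists_mk (Ψ (mk p.1 p.2))
    have h1 := hsθ p
    rw [h, angle_mk, ← sub_eq_zero, ← AddCircle.coe_sub, AddCircle.coe_eq_zero_iff] at h1
    obtain ⟨j, hj⟩ := h1
    refine ⟨sh (-j) y, h.trans (mk_eq_mk_iff.2 ⟨-j, rfl, ?_⟩)⟩
    push_cast
    simp only [zsmul_eq_mul, mul_one] at hj
    linarith
  choose F hF using hex
  have hFc : Continuous F := continuous_iff_continuousAt.2 fun p => by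
    intro V hV
    change ∀ᶠ q in 𝓝 p, F q ∈ V
    obtain ⟨V', hV'V, hV', hpV'⟩ := mem_nhds_iff.1 hV
    have hU : IsOpen ((fun q : Y.carrier × ℝ => mk q.1 q.2) ''
        (V' ×ˢ Metric.ball (s p) (1 / 2))) :=
      isOpenMap_mk _ (hV'.prod Metric.isOpen_ball)
    have h1 : ∀ᶠ q in 𝓝 p, Ψ (mk q.1 q.2) ∈ ((fun q : Y.carrier × ℝ => mk q.1 q.2) ''
        (V' ×ˢ Metric.ball (s p) (1 / 2))) :=
      (hΨ.comp continuous_mk).continuousAt.eventually (hU.mem_nhds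
        ⟨(F p, s p), ⟨hpV', Metric.mem_ball_self (by norm_num)⟩, (hF p).symm⟩)
    have h2 : ∀ᶠ q in 𝓝 p, s q ∈ Metric.ball (s p) (1 / 2) :=
      hs.continuousAt.eventually (Metric.ball_mem_nhds _ (by norm_num))
    filter_upwards [h1, h2] with q h1 h2
    obtain ⟨⟨y, t⟩, ⟨hy, ht⟩, h⟩ := h1
    obtain ⟨j, hj1, hj2⟩ := mk_eq_mk_iff.1 (h.trans (hF q))
    -- Representatives are unique up to an integer time shift, and both times lie in a ball of
    -- radius `1/2`.
    have hj : j = 0 := by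
      refine abs_sub_lt_one_of_int hj2 ?_
      rw [Metric.mem_ball, Real.dist_eq] at h2 ht
      rw [abs_lt] at *
      constructor <;> linarith [h2.1, h2.2, ht.1, ht.2]
    apply hV'V
    rw [hj1, hj, sh_zero]
    exact hy
  -- The line is connected and `Y` is totally disconnected.
  have hconst : ∀ x t, F (x, t) = F (x, 0) := fun x t => by
    have hc : Continuous fun t => F (x, t) := hFc.comp (by fun_prop)
    exact (isPreconnected_range hc).subsingleton ⟨t, rfl⟩ ⟨0, rfl⟩
  exact ⟨fun x => F (x, 0), fun x t => s (x, t), hFc.comp (by fun_prop), hs,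
    fun x t => (hF (x, t)).trans (by rw [hconst])⟩

/-- A continuous map `f` between subshifts that sends orbits to orbits, with a continuous integer
cocycle `N` recording the displacement along them. -/
structure CocycleMap (X : Subshift A ℤ) (Y : Subshift B ℤ) where
  f : X.carrier → Y.carrier
  N : X.carrier → ℤ → ℤ
  continuous_f : Continuous f
  continuous_N : ∀ j, Continuous fun x => N x j
  f_sh : ∀ x j, f (sh j x) = sh (N x j) (f x)
  N_add : ∀ x i j, N x (i + j) = N x i + N (sh i x) j

lemma exists_int_of_continuous {Z : Type*} [TopologicalSpace Z] {h : Z → ℝ → ℝ}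
    (hc : Continuous fun q : Z × ℝ => h q.1 q.2) (hi : ∀ z t, ∃ n : ℤ, h z t = n) :
    ∃ N : Z → ℤ, Continuous N ∧ ∀ z t, h z t = N z := by
  choose N hN using hi
  have hNc : Continuous fun q : Z × ℝ => N q.1 q.2 := by
    rw [Int.isClosedEmbedding_coe_real.isInducing.continuous_iff]
    exact hc.congr fun q => hN q.1 q.2
  refine ⟨fun z => N z 0, hNc.comp (by fun_prop : Continuous fun z : Z => (z, (0 : ℝ))),
    fun z t => ?_⟩
  rw [hN]
  have hc : Continuous fun t => N z t := hNc.comp (by fun_prop : Continuous fun t => (z, t))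
  exact congrArg _ ((isPreconnected_range hc).subsingleton ⟨t, rfl⟩ ⟨0, rfl⟩)

/-- A continuous map between suspensions induces a cocycle map, whose cocycle is the increment of
the lifted time. -/
theorem Suspension.exists_cocycleMap [Finite A] [DiscreteTopology A] [DiscreteTopology B]
    {X : Subshift A ℤ} {Y : Subshift B ℤ} {Ψ : Suspension X → Suspension Y} (hΨ : Continuous Ψ) :
    ∃ (F : CocycleMap X Y) (s : X.carrier → ℝ → ℝ),
      Continuous (fun p : X.carrier × ℝ => s p.1 p.2) ∧
      (∀ x t, Ψ (mk x t) = mk (F.f x) (s x t)) ∧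
      ∀ x t (j : ℤ), s x (t + j) = s (sh j x) t + F.N x j := by
  obtain ⟨f, s, hf, hs, h⟩ := exists_lift hΨ
  have key : ∀ x t (j : ℤ), ∃ n : ℤ, f (sh j x) = sh n (f x) ∧ s x (t + j) = s (sh j x) t + n := by
    intro x t j
    refine mk_eq_mk_iff.1 ?_
    rw [← h, ← h, mk_add_intCast]
  have hN : ∀ j : ℤ, ∃ N : X.carrier → ℤ, Continuous N ∧
      ∀ x t, s x (t + j) - s (sh j x) t = N x := fun j =>
    exists_int_of_continuous (h := fun x t => s x (t + j) - s (sh j x) t)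
      ((hs.comp (by fun_prop : Continuous fun q : X.carrier × ℝ => (q.1, q.2 + (j : ℝ)))).sub
        (hs.comp (((continuous_sh j).comp continuous_fst).prodMk continuous_snd)))
      fun x t => by
        obtain ⟨n, -, hn⟩ := key x t j
        exact ⟨n, by rw [hn]; ring⟩
  choose N hNc hN using hN
  refine ⟨⟨f, fun x j => N j x, hf, hNc, fun x j => ?_, fun x i j => ?_⟩, s, hs, h,
    fun x t j => by rw [← hN j x t]; ring⟩
  · obtain ⟨n, hn, hn'⟩ := key x 0 j
    have : n = N j x := by
      have := hN j x 0
      rw [hn'] at this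
      exact_mod_cast (by linarith : (n : ℝ) = N j x)
    rw [hn, this]
  · have h1 := hN (i + j) x 0
    have h2 := hN i x j
    have h3 := hN j (sh i x) 0
    rw [sh_sh] at h3
    have : ((i + j : ℤ) : ℝ) = j + i := by push_cast; ring
    rw [this, zero_add] at h1
    rw [zero_add] at h3
    exact_mod_cast (by linarith : (N (i + j) x : ℝ) = N i x + N j (sh i x))

/-- The integer correction would be a strictly increasing map from `ℝ` to `ℤ`. This rules out
reversal of time in the lift. -/
lemma not_strictAnti_of_monotone_add_int {s φ : ℝ → ℝ} (hφ : Monotone φ) (c : ℝ)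
    (h : ∀ r, ∃ j : ℤ, c + φ r = s r + j) : ¬ StrictAnti s := by
  intro hs
  choose j hj using h
  have hmono : StrictMono j := fun a b hab => by
    have h1 := hs hab
    have h2 := hφ hab.le
    have h3 := hj a
    have h4 := hj b
    exact_mod_cast (by linarith : (j a : ℝ) < j b)
  exact not_countable (α := ℝ) hmono.injective.countable

/-- A flow equivalence induces mutually inverse (up to displacement along orbits) cocycle maps,
whose cocycles are compatible at the fixed points. -/
theorem FlowEquivalent.exists_cocycleMaps [Finite A] [DiscreteTopology A] [Finite B]
    [DiscreteTopology B] {X : Subshift A ℤ} {Y : Subshift B ℤ} (h : FlowEquivalent X Y) :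
    ∃ (F : CocycleMap X Y) (G : CocycleMap Y X),
      (∀ x, ∃ k, G.f (F.f x) = sh k x) ∧ (∀ y, ∃ k, F.f (G.f y) = sh k y) ∧
      (∀ p, sh 1 p = p → 0 < F.N p 1 ∧ G.N (F.f p) (F.N p 1) = 1) ∧
      (∀ p, sh 1 p = p → 0 < G.N p 1 ∧ F.N (G.f p) (G.N p 1) = 1) := by
  obtain ⟨Φ, hΦ⟩ := h
  obtain ⟨F, s, hs, hF, hFN⟩ := Suspension.exists_cocycleMap Φ.continuous
  obtain ⟨G, u, hu, hG, hGN⟩ := Suspension.exists_cocycleMap Φ.symm.continuous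
  have keyF : ∀ x t, ∃ j : ℤ, G.f (F.f x) = sh j x ∧ t = u (F.f x) (s x t) + j := fun x t => by
    refine Suspension.mk_eq_mk_iff.1 ?_
    rw [← hG, ← hF, Φ.symm_apply_apply]
  have keyG : ∀ x t, ∃ j : ℤ, F.f (G.f x) = sh j x ∧ t = s (G.f x) (u x t) + j := fun x t => by
    refine Suspension.mk_eq_mk_iff.1 ?_
    rw [← hF, ← hG, Φ.apply_symm_apply]
  -- The composite of the lifted times is a translation by an integer independent of `t`. This
  -- yields injectivity of `s x`, and the cocycle identity at fixed points by comparing times `0`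
  -- and `1`.
  obtain ⟨κ, -, hκ⟩ := exists_int_of_continuous (h := fun x t => t - u (F.f x) (s x t))
    (continuous_snd.sub (hu.comp ((F.continuous_f.comp continuous_fst).prodMk hs)))
    fun x t => by
      obtain ⟨j, -, hj⟩ := keyF x t
      exact ⟨j, by linarith⟩
  obtain ⟨μ, -, hμ⟩ := exists_int_of_continuous (h := fun x t => t - s (G.f x) (u x t))
    (continuous_snd.sub (hs.comp ((G.continuous_f.comp continuous_fst).prodMk hu)))
    fun x t => by
      obtain ⟨j, -, hj⟩ := keyG x t
      exact ⟨j, by linarith⟩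
  have hsm : ∀ x, StrictMono (s x) := fun x => by
    have hc : Continuous (s x) := hs.comp (by fun_prop : Continuous fun t => (x, t))
    have hinj : Function.Injective (s x) := fun a b hab => by
      have h1 := hκ x a
      have h2 := hκ x b
      rw [hab] at h1
      linarith
    refine (hc.strictMono_of_inj hinj).resolve_right ?_
    obtain ⟨φ, hφ, hr⟩ := hΦ x 0
    refine not_strictAnti_of_monotone_add_int hφ (s x 0) fun r => ?_
    have h1 := hr _ _ (hF x 0) r
    rw [zero_add, hF] at h1
    obtain ⟨j, -, hj⟩ := Suspension.mk_eq_mk_iff.1 h1.symm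
    exact ⟨j, hj⟩
  have hum : ∀ y, StrictMono (u y) := fun y => by
    have hc : Continuous (u y) := hu.comp (by fun_prop : Continuous fun t => (y, t))
    have hinj : Function.Injective (u y) := fun a b hab => by
      have h1 := hμ y a
      have h2 := hμ y b
      rw [hab] at h1
      linarith
    refine (hc.strictMono_of_inj hinj).resolve_right fun ha => ?_
    have h1 := hsm (G.f y) (ha (zero_lt_one' ℝ))
    have h2 := hμ y 0
    have h3 := hμ y 1
    linarith
  refine ⟨F, G, fun x => (keyF x 0).imp fun _ => And.left, fun y => (keyG y 0).imp fun _ => And.left,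
    fun p hp => ?_, fun p hp => ?_⟩
  · have h1 := hFN p 0 1
    rw [hp] at h1
    have h2 := hGN (F.f p) (s p 0) (F.N p 1)
    rw [← F.f_sh, hp] at h2
    have h3 := hκ p 0
    have h4 := hκ p 1
    have h5 := hsm p (zero_lt_one' ℝ)
    simp only [Int.cast_one, zero_add] at h1
    rw [← h1] at h2
    exact ⟨by exact_mod_cast (by linarith : (0 : ℝ) < F.N p 1),
      by exact_mod_cast (by linarith : (G.N (F.f p) (F.N p 1) : ℝ) = 1)⟩
  · have h1 := hGN p 0 1
    rw [hp] at h1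
    have h2 := hFN (G.f p) (u p 0) (G.N p 1)
    rw [← G.f_sh, hp] at h2
    have h3 := hμ p 0
    have h4 := hμ p 1
    have h5 := hum p (zero_lt_one' ℝ)
    simp only [Int.cast_one, zero_add] at h1
    rw [← h1] at h2
    exact ⟨by exact_mod_cast (by linarith : (0 : ℝ) < G.N p 1),
      by exact_mod_cast (by linarith : (F.N (G.f p) (G.N p 1) : ℝ) = 1)⟩

end Suspension

/-! ### Finite windows, and transport of glued points by cocycle maps. -/

section Transport

variable {A B : Type*} [TopologicalSpace A] [TopologicalSpace B]

/-- A continuous map from a subshift to a discrete space depends on finitely many coordinates. -/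
lemma exists_window [Finite A] [DiscreteTopology A] {X : Subshift A ℤ} {D : Type*} [TopologicalSpace D]
    [DiscreteTopology D] {F : X.carrier → D} (hF : Continuous F) :
    ∃ R : ℤ, 0 ≤ R ∧ ∀ x x' : X.carrier,
      (∀ i, |i| ≤ R → (x : ℤ → A) i = (x' : ℤ → A) i) → F x = F x' := by
  have h1 : ∀ x : X.carrier, ∃ R : ℤ, 0 ≤ R ∧ ∀ x' : X.carrier,
      (∀ i, |i| ≤ R → (x' : ℤ → A) i = (x : ℤ → A) i) → F x' = F x := by
    intro x
    obtain ⟨O, hO, hOF⟩ := isOpen_induced_iff.1 ((isOpen_discrete {F x}).preimage hF)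
    have hxO : (x : ℤ → A) ∈ O := by
      have : x ∈ Subtype.val ⁻¹' O := by rw [hOF]; rfl
      exact this
    obtain ⟨I, v, hv, hIv⟩ := isOpen_pi_iff.1 hO x hxO
    obtain ⟨R, hR⟩ : ∃ R : ℤ, ∀ i ∈ I, |i| ≤ R := by
      obtain ⟨R, hR⟩ := (I.image fun i => |i|).bddAbove
      exact ⟨R, fun i hi => hR (by simpa using ⟨i, hi, rfl⟩)⟩
    refine ⟨max R 0, le_max_right _ _, fun x' hx' => ?_⟩
    have : x' ∈ Subtype.val ⁻¹' O := hIv fun i hi => by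
      rw [hx' i ((hR i hi).trans (le_max_left _ _))]
      exact (hv i hi).2
    rw [hOF] at this
    exact this
  choose R hR0 hR using h1
  let V : X.carrier → Set X.carrier := fun x =>
    Subtype.val ⁻¹' cylinder (Finset.Icc (-R x) (R x)) (x : ℤ → A)
  obtain ⟨t, -, ht⟩ := isCompact_univ.elim_nhds_subcover V fun x _ =>
    ((isOpen_cylinder _ _).preimage continuous_subtype_val).mem_nhds fun i _ => rfl
  obtain ⟨S, hS⟩ := (t.image R).bddAbove
  refine ⟨max S 0, le_max_right _ _, fun x x' hxx' => ?_⟩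
  obtain ⟨y, hy, hxy⟩ := Set.mem_iUnion₂.1 (ht (Set.mem_univ x))
  have hyS : R y ≤ S := hS (Finset.mem_coe.2 (Finset.mem_image_of_mem R hy))
  have hxy' : ∀ i, |i| ≤ R y → (x : ℤ → A) i = (y : ℤ → A) i := fun i hi =>
    hxy i (by rw [Finset.mem_Icc]; exact abs_le.1 hi)
  rw [hR y x hxy', hR y x' fun i hi => by
    rw [← hxx' i (hi.trans (hyS.trans (le_max_left _ _))), hxy' i hi]]

namespace CocycleMap

variable {X : Subshift A ℤ} {Y : Subshift B ℤ} (F : CocycleMap X Y)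

@[simp] lemma N_zero (x : X.carrier) : F.N x 0 = 0 := by
  have := F.N_add x 0 0
  simpa using this

lemma N_sub (x : X.carrier) (i j : ℤ) : F.N (sh i x) (j - i) = F.N x j - F.N x i := by
  have := F.N_add x i (j - i)
  rw [add_sub_cancel] at this
  omega

lemma N_add_one (x : X.carrier) (i : ℤ) : F.N x (i + 1) = F.N x i + F.N (sh i x) 1 :=
  F.N_add x i 1

lemma f_apply (x : X.carrier) (j b : ℤ) :
    (F.f x : ℤ → B) (F.N x j + b) = (F.f (sh j x) : ℤ → B) b := by
  rw [F.f_sh]; rfl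

/-- A window `R` that determines the displacement under the shift, which is bounded by `C`, and the
central coordinates of the image within distance `C`. -/
structure IsWindow (C R : ℤ) : Prop where
  nonneg_left : 0 ≤ C
  nonneg_right : 0 ≤ R
  bound : ∀ x, |F.N x 1| ≤ C
  N_eq : ∀ x x' : X.carrier, (∀ i, |i| ≤ R → (x : ℤ → A) i = (x' : ℤ → A) i) → F.N x 1 = F.N x' 1
  f_eq : ∀ x x' : X.carrier, (∀ i, |i| ≤ R → (x : ℤ → A) i = (x' : ℤ → A) i) →
    ∀ b, |b| ≤ C → (F.f x : ℤ → B) b = (F.f x' : ℤ → B) b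

/-- Compactness bounds the displacement. Coordinates of the image within one maximal step `C` of
each visited position suffice to reach all those between visits; `C₀` allows a whole period to be
read as well. -/
lemma exists_isWindow [Finite A] [DiscreteTopology A] [DiscreteTopology B] (C₀ : ℤ) :
    ∃ C R, C₀ ≤ C ∧ F.IsWindow C R := by
  obtain ⟨C, hC⟩ := (isCompact_range (F.continuous_N 1).abs).bddAbove
  have hC' : ∀ x, |F.N x 1| ≤ max C (max C₀ 0) := fun x => (hC ⟨x, rfl⟩).trans (le_max_left _ _)
  obtain ⟨R, hR, h⟩ := exists_window
    (F := fun x => (F.N x 1, fun b : Finset.Icc (-max C (max C₀ 0)) (max C (max C₀ 0)) =>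
      (F.f x : ℤ → B) b))
    ((F.continuous_N 1).prodMk (continuous_pi fun b =>
      (continuous_apply (b : ℤ)).comp (continuous_subtype_val.comp F.continuous_f)))
  refine ⟨_, R, (le_max_left _ _).trans (le_max_right _ _),
    (le_max_right _ _).trans (le_max_right _ _), hR, hC',
    fun x x' hx => congrArg Prod.fst (h x x' hx), fun x x' hx b hb => ?_⟩
  exact congr_fun (congrArg Prod.snd (h x x' hx)) ⟨b, Finset.mem_Icc.2 (abs_le.1 hb)⟩

/-- If the displacements along two orbits agree on an interval of times containing `0`, then so do
the cocycles. -/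
lemma N_congr {x x' : X.carrier} {lo hi : ℤ}
    (h : ∀ j, lo ≤ j → j < hi → F.N (sh j x) 1 = F.N (sh j x') 1) (hlo : lo ≤ 0) (hhi : 0 ≤ hi)
    (j : ℤ) (h1 : lo ≤ j) (h2 : j ≤ hi) : F.N x j = F.N x' j := by
  induction j using Int.induction_on with
  | zero => simp
  | succ i ih => rw [N_add_one, N_add_one, ih (by omega) (by omega), h _ (by omega) (by omega)]
  | pred i ih =>
    have e1 := F.N_add_one x (-i - 1)
    have e2 := F.N_add_one x' (-i - 1)
    rw [sub_add_cancel] at e1 e2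
    have := ih (by omega) (by omega)
    have := h (-i - 1) (by omega) (by omega)
    omega

lemma abs_N_le {C R : ℤ} (hw : F.IsWindow C R) (x : X.carrier) (j : ℕ) : |F.N x j| ≤ C * j := by
  induction j with
  | zero => simp
  | succ j ih =>
    push_cast
    rw [N_add_one]
    calc _ ≤ _ := abs_add_le _ _
      _ ≤ C * j + C := add_le_add ih (hw.bound _)
      _ = _ := by ring

end CocycleMap

/-- The image of an integer sequence with steps at most `C` that is unbounded below to the left is
`C`-dense below each of its values. -/
lemma exists_abs_sub_le_of_steps {u : ℤ → ℤ} {C a m : ℤ} (hstep : ∀ j, |u (j + 1) - u j| ≤ C)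
    (hm : m ≤ u a) (hlow : ∃ j ≤ a, u j ≤ m) : ∃ j ≤ a, |m - u j| ≤ C := by
  obtain ⟨j, hj, hjm⟩ := hlow
  obtain ⟨k, rfl⟩ : ∃ k : ℕ, a = j + k := ⟨(a - j).toNat, by omega⟩
  have hC : 0 ≤ C := (abs_nonneg _).trans (hstep 0)
  clear hj
  induction k generalizing j with
  | zero =>
    refine ⟨j, by simp, ?_⟩
    have : u j = m := le_antisymm hjm (by simpa using hm)
    simpa [this] using hC
  | succ k ih =>
    rcases le_or_gt (u (j + 1)) m with h | h
    · obtain ⟨i, hi, hi'⟩ := ih (j + 1) h (by convert hm using 2; push_cast; ring)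
      exact ⟨i, by push_cast at *; omega, hi'⟩
    · have := abs_le.1 (hstep j)
      exact ⟨j, by push_cast; omega, abs_le.2 ⟨by omega, by omega⟩⟩

lemma exists_abs_sub_le_of_steps' {u : ℤ → ℤ} {C a m : ℤ} (hstep : ∀ j, |u (j + 1) - u j| ≤ C)
    (hm : u a ≤ m) (hhigh : ∃ j, a ≤ j ∧ m ≤ u j) : ∃ j, a ≤ j ∧ |m - u j| ≤ C := by
  obtain ⟨j, hj, hjm⟩ := hhigh
  obtain ⟨i, hi, h⟩ := exists_abs_sub_le_of_steps (u := fun j => -u (-j)) (a := -a) (m := -m) (C := C)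
    (fun j => by
      have := hstep (-j - 1)
      rw [sub_add_cancel, show -j - 1 = -(j + 1) by ring] at this
      rw [show -u (-(j + 1)) - -u (-j) = u (-j) - u (-(j + 1)) by ring]
      exact this) (by simpa using hm) ⟨-j, by omega, by simpa using hjm⟩
  refine ⟨-i, by omega, ?_⟩
  rw [show m - u (-i) = -(-m - -u (-i)) by ring, abs_neg]
  exact h

/-- A sequence that increases along an arithmetic progression far away from `0`, on both sides, is
unbounded. -/
lemma exists_le_of_growth {u : ℤ → ℤ} {k I : ℤ} (hk : 0 < k)
    (h : ∀ i, i ≤ -I → u i + 1 ≤ u (i + k)) (a m : ℤ) : ∃ j ≤ a, u j ≤ m := by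
  have key : ∀ (n : ℕ) (b : ℤ), b ≤ -I → u (b - k * n) + n ≤ u b := by
    intro n b hb
    induction n with
    | zero => simp
    | succ n ih =>
      have h1 : 0 ≤ k * n := by positivity
      have h2 := h (b - k * (n + 1 : ℕ)) (by push_cast; nlinarith)
      rw [show b - k * (n + 1 : ℕ) + k = b - k * n by push_cast; ring] at h2
      push_cast at *
      omega
  have hb : min a (-I) ≤ -I := min_le_right _ _
  refine ⟨min a (-I) - k * (u (min a (-I)) - m).toNat, ?_, ?_⟩
  · have : 0 ≤ k * (u (min a (-I)) - m).toNat := by positivity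
    have := min_le_left a (-I)
    omega
  · have := key (u (min a (-I)) - m).toNat _ hb
    omega

lemma exists_ge_of_growth {u : ℤ → ℤ} {k I : ℤ} (hk : 0 < k)
    (h : ∀ i, I ≤ i → u i + 1 ≤ u (i + k)) (a m : ℤ) : ∃ j, a ≤ j ∧ m ≤ u j := by
  obtain ⟨j, hj, hjm⟩ := exists_le_of_growth (u := fun j => -u (-j)) (I := I + k) hk (fun i hi => by
    have := h (-(i + k)) (by omega)
    rw [show -(i + k) + k = -i by ring] at this
    omega) (-a) (-m)
  exact ⟨-j, by omega, by omega⟩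

/-- `z` follows `x` up to time `D - J`, and the translate of `x` by `D` from time `J` on. -/
def IsGlued (x : ℤ → A) (D J : ℤ) (z : ℤ → A) : Prop :=
  (∀ j, j ≤ D - J → z j = x j) ∧ ∀ j, J ≤ j → z j = x (j - D)

namespace CocycleMap

variable [Finite A] [DiscreteTopology A] [DiscreteTopology B] {X : Subshift A ℤ}
  {Y : Subshift B ℤ} (F : CocycleMap X Y)

/-- Cocycle maps carry glued points to glued points. -/
theorem exists_isGlued (x : X.carrier) {k I : ℤ} (hk : 0 < k)
    (hleft : ∀ i, i ≤ -I → 1 ≤ F.N (sh i x) k) (hright : ∀ i, I ≤ i → 1 ≤ F.N (sh i x) k) (J : ℤ) :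
    ∃ c e J' D₀ : ℤ, ∀ D, D₀ ≤ D → ∀ z : X.carrier, IsGlued (x : ℤ → A) D J z →
      IsGlued (F.f x : ℤ → B) (F.N x (D - c) + e) J' (F.f z) := by
  -- Being glued is a weaker condition for larger `J`.
  wlog hJ : 0 ≤ J generalizing J
  · obtain ⟨c, e, J', D₀, h⟩ := this 0 le_rfl
    exact ⟨c, e, J', D₀, fun D hD z hz =>
      h D hD z ⟨fun j hj => hz.1 j (by omega), fun j hj => hz.2 j (by omega)⟩⟩
  obtain ⟨C, R, -, hw⟩ := F.exists_isWindow 0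
  have hR := hw.nonneg_right
  have hstep : ∀ j, |F.N x (j + 1) - F.N x j| ≤ C := fun j => by
    rw [N_add_one, add_sub_cancel_left]; exact hw.bound _
  have hlow := exists_le_of_growth hk (u := F.N x) (I := I) fun i hi => by
    rw [F.N_add x i k]; have := hleft i hi; omega
  have hhigh := exists_ge_of_growth hk (u := F.N x) (I := I) fun i hi => by
    rw [F.N_add x i k]; have := hright i hi; omega
  obtain ⟨n, hn⟩ : ∃ n : ℕ, J + R = n := ⟨(J + R).toNat, by omega⟩
  -- With margin `n = J + R`, windows stay where `z` follows a single copy. The displacement of `z`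
  -- up to `D` is that of `x` up to `D - n`, then over its last `n` steps before `0`; `C * n` bounds
  -- the movement in `n` steps.
  refine ⟨n, -F.N x (-n), C * n, 2 * n, fun D hD z hz => ?_⟩
  have hagreeL : ∀ j, j ≤ D - n → ∀ i, |i| ≤ R → (sh j z : ℤ → A) i = (sh j x : ℤ → A) i :=
    fun j hj i hi => by
      rw [abs_le] at hi
      exact hz.1 _ (by omega)
  have hagreeR : ∀ j, n - D ≤ j →
      ∀ i, |i| ≤ R → (sh j (sh D z) : ℤ → A) i = (sh j x : ℤ → A) i := fun j hj i hi => by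
    rw [abs_le] at hi
    simp only [sh_apply]
    rw [hz.2 _ (by omega)]
    exact congrArg _ (by omega)
  have hNL : ∀ j, j ≤ D - n → F.N z j = F.N x j := fun j hj =>
    F.N_congr (lo := min j 0) (hi := D - n) (fun j' _ h => hw.N_eq _ _ (hagreeL j' h.le))
      (min_le_right _ _) (by omega) j (min_le_left _ _) hj
  have hNR : ∀ j, n - D ≤ j → F.N (sh D z) j = F.N x j := fun j hj =>
    F.N_congr (lo := n - D) (hi := max j 0) (fun j' h _ => hw.N_eq _ _ (hagreeR j' h))
      (by omega) (le_max_right _ _) j hj (le_max_left _ _)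
  have hD' : F.N x (D - n) + -F.N x (-n) = F.N z D := by
    have h1 := F.N_add z D (-n)
    rw [hNR _ (by omega), ← sub_eq_add_neg, hNL _ le_rfl] at h1
    omega
  rw [hD']
  constructor
  · intro m hm
    have hm' : m ≤ F.N x (D - n) := by
      have h1 := F.N_add z (D - n) n
      rw [sub_add_cancel, hNL _ le_rfl] at h1
      have h2 := abs_le.1 (F.abs_N_le hw (sh (D - n) z) n)
      omega
    -- Some time `j` in the zone of agreement is sent within `C` of `m`, so the window at `j`
    -- determines coordinate `m`.
    obtain ⟨j, hj, hmj⟩ := exists_abs_sub_le_of_steps hstep hm' (hlow _ _)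
    have h1 := F.f_apply z j (m - F.N x j)
    have h2 := F.f_apply x j (m - F.N x j)
    rw [hNL j hj, add_sub_cancel] at h1
    rw [add_sub_cancel] at h2
    rw [h1, h2]
    exact hw.f_eq _ _ (hagreeL j hj) _ hmj
  · intro m hm
    have hm' : F.N x (n - D) ≤ m - F.N z D := by
      have h1 := F.N_sub z D n
      rw [hNR _ le_rfl] at h1
      have h2 := abs_le.1 (F.abs_N_le hw z n)
      omega
    obtain ⟨j, hj, hmj⟩ := exists_abs_sub_le_of_steps' hstep hm' (hhigh _ _)
    have h1 := F.f_apply (sh D z) j (m - F.N z D - F.N x j)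
    have h2 := F.f_apply x j (m - F.N z D - F.N x j)
    rw [hNR j hj, add_sub_cancel, F.f_sh, sh_apply, add_sub_cancel] at h1
    rw [add_sub_cancel] at h2
    rw [h1, h2]
    exact hw.f_eq _ _ (hagreeR j hj) _ hmj

end CocycleMap

end Transport

/-! ### Gap shifts and their test points. -/

section GapShift

lemma eq_zero_of_ne_one {a : Fin 2} (h : a ≠ 1) : a = 0 := by
  revert a; decide

lemma occursInAt_wordPattern {A : Type*} [Inhabited A] {w : List A} {x : ℤ → A} {g : ℤ} :
    (wordPattern w).occursInAt x g ↔ ∀ (n : ℕ) (hn : n < w.length), x (g + n) = w[n] := by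
  constructor
  · intro h n hn
    have h1 := h n (by simpa [wordPattern] using hn)
    simpa [wordPattern, hn] using h1
  · intro h i hi
    obtain ⟨h0, hlt⟩ := Finset.mem_Ico.1 hi
    obtain ⟨n, rfl⟩ := Int.eq_ofNat_of_zero_le h0
    have hn : n < w.length := by exact_mod_cast hlt
    simpa [wordPattern, hn] using h n hn

lemma occursInAt_replicate {x : ℤ → Fin 2} {g : ℤ} {k : ℕ} :
    (wordPattern (List.replicate k (0 : Fin 2))).occursInAt x g ↔ ∀ n : ℕ, n < k → x (g + n) = 0 := by
  simp [occursInAt_wordPattern]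

lemma occursInAt_gap {x : ℤ → Fin 2} {g : ℤ} {k : ℕ} :
    (wordPattern (1 :: (List.replicate k (0 : Fin 2) ++ [1]))).occursInAt x g ↔
      x g = 1 ∧ x (g + k + 1) = 1 ∧ ∀ j, g < j → j < g + k + 1 → x j = 0 := by
  rw [occursInAt_wordPattern]
  constructor
  · intro h
    refine ⟨by simpa using h 0 (by simp), ?_, fun j h1 h2 => ?_⟩
    · have := h (k + 1) (by simp)
      simp only [List.getElem_cons_succ] at this
      rw [List.getElem_append_right (by simp)] at this
      simpa [add_assoc] using this
    · obtain ⟨n, hn⟩ := Int.eq_ofNat_of_zero_le (show 0 ≤ j - g - 1 by omega)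
      have hnk : n < k := by omega
      have := h (n + 1) (by simp; omega)
      simp only [List.getElem_cons_succ] at this
      rw [List.getElem_append_left (by simpa using hnk), List.getElem_replicate] at this
      rw [← this]
      congr 1
      push_cast
      omega
  · rintro ⟨h0, h1, h2⟩ n hn
    rcases n with _ | n
    · simpa using h0
    · simp only [List.getElem_cons_succ]
      simp only [List.length_cons, List.length_append, List.length_replicate, List.length_nil] at hn
      rcases lt_or_eq_of_le (show n ≤ k by omega) with hnk | rfl
      · rw [List.getElem_append_left (by simpa using hnk), List.getElem_replicate]
        exact h2 _ (by push_cast; omega) (by push_cast; omega)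
      · rw [List.getElem_append_right (by simp)]
        simpa [add_assoc] using h1

/-- A point lies in the `S`-gap shift iff its gaps lie in `S` and, for finite `S`, its runs of zeros
have length at most `max S`. -/
lemma mem_gapShift {S : Set ℕ} (hS : S.Nonempty) {x : ℤ → Fin 2} :
    x ∈ (gapShift S).carrier ↔
      (∀ (g : ℤ) (k : ℕ), x g = 1 → x (g + k + 1) = 1 →
        (∀ j, g < j → j < g + k + 1 → x j = 0) → k ∈ S) ∧
      (S.Finite → ∀ g : ℤ, ∃ j, g ≤ j ∧ j ≤ g + sSup S ∧ x j = 1) := by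
  have hmem : x ∈ (gapShift S).carrier ↔
      ∀ w ∈ gapForbidden S, ∀ g, ¬ (wordPattern w).occursInAt x g :=
    Set.forall_mem_image
  rw [hmem]
  constructor
  · intro h
    have hrun : S.Finite → ∀ g : ℤ, ∃ j, g ≤ j ∧ j ≤ g + sSup S ∧ x j = 1 := by
      intro hfin g
      have h1 := h _ (Or.inr ⟨hfin, rfl⟩) g
      rw [occursInAt_replicate] at h1
      push Not at h1
      obtain ⟨n, hn, hne⟩ := h1
      exact ⟨g + n, by omega, by omega, by by_contra hc; exact hne (eq_zero_of_ne_one hc)⟩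
    refine ⟨fun g k h0 h1 h2 => ?_, hrun⟩
    by_contra hk
    by_cases hlt : S.Finite → k < sSup S
    · exact h _ (Or.inl ⟨k, hk, hlt, rfl⟩) g (occursInAt_gap.2 ⟨h0, h1, h2⟩)
    · push Not at hlt
      obtain ⟨hfin, hle⟩ := hlt
      -- For finite `S` a gap not below the maximum and not in `S` exceeds it, so it contains the
      -- forbidden run of zeros.
      have hne : sSup S ≠ k := fun he => hk (he ▸ Nat.sSup_mem hS hfin.bddAbove)
      obtain ⟨j, hj1, hj2, hj⟩ := hrun hfin (g + 1)
      rw [h2 j (by omega) (by omega)] at hj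
      exact absurd hj (by decide)
  · rintro ⟨hgap, hrun⟩ w (⟨k, hk, -, rfl⟩ | ⟨hfin, rfl⟩) g hocc
    · obtain ⟨h0, h1, h2⟩ := occursInAt_gap.1 hocc
      exact hk (hgap g k h0 h1 h2)
    · obtain ⟨j, hj1, hj2, hj⟩ := hrun hfin g
      obtain ⟨n, hn⟩ := Int.eq_ofNat_of_zero_le (show 0 ≤ j - g by omega)
      have h1 := occursInAt_replicate.1 hocc n (by omega)
      rw [show g + (n : ℤ) = j by omega, hj] at h1
      exact absurd h1 (by decide)

/-- The symbol `1` is synchronizing in a gap shift. -/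
lemma glue_mem_gapShift {S : Set ℕ} (hS : S.Nonempty) {y y' : ℤ → Fin 2}
    (hy : y ∈ (gapShift S).carrier) (hy' : y' ∈ (gapShift S).carrier) {t : ℤ} (ht : y t = 1)
    (ht' : y' t = 1) : (fun j => if j ≤ t then y j else y' j) ∈ (gapShift S).carrier := by
  rw [mem_gapShift hS] at *
  have hR : ∀ j, t ≤ j → (if j ≤ t then y j else y' j) = y' j := fun j hj => by
    rcases hj.eq_or_lt with rfl | h
    · rw [if_pos le_rfl, ht, ht']
    · rw [if_neg (not_le.2 h)]
  refine ⟨fun g k h0 h1 h2 => ?_, fun hfin g => ?_⟩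
  · rcases le_or_gt t g with hg | hg
    · rw [hR _ hg] at h0
      rw [hR _ (by omega)] at h1
      exact hy'.1 g k h0 h1 fun j hj hj' => by rw [← h2 j hj hj', hR _ (by omega)]
    · rcases le_or_gt (g + k + 1) t with hg' | hg'
      · rw [if_pos hg.le] at h0
        rw [if_pos hg'] at h1
        exact hy.1 g k h0 h1 fun j hj hj' => by rw [← h2 j hj hj', if_pos (by omega)]
      · have := h2 t hg hg'
        rw [if_pos le_rfl, ht] at this
        exact absurd this (by decide)
  · rcases le_or_gt t g with hg | hg
    · obtain ⟨j, hj, hj', h⟩ := hy'.2 hfin g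
      exact ⟨j, hj, hj', by rw [hR j (by omega), h]⟩
    · obtain ⟨j, hj, hj', h⟩ := hy.2 hfin g
      rcases le_or_gt j t with hjt | hjt
      · exact ⟨j, hj, hj', by simp only [if_pos hjt, h]⟩
      · exact ⟨t, hg.le, by omega, by simp only [le_refl, if_true, ht]⟩

/-- The fixed point `0^∞` of a gap shift. -/
def zeroPt {S : Set ℕ} (hS : S.Infinite) : (gapShift S).carrier :=
  ⟨fun _ => 0, (mem_gapShift hS.nonempty).2
    ⟨fun _ _ h => absurd h (by decide), fun h => absurd h hS⟩⟩

/-- The point `0^∞ 1 0^∞` of a gap shift. -/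
def onePt {S : Set ℕ} (hS : S.Infinite) : (gapShift S).carrier :=
  ⟨fun j => if j = 0 then 1 else 0, (mem_gapShift hS.nonempty).2
    ⟨fun g k h0 h1 _ => by
      have h0' : g = 0 := by
        by_contra h
        rw [if_neg h] at h0
        exact absurd h0 (by decide)
      have h1' : g + k + 1 = 0 := by
        by_contra h
        rw [if_neg h] at h1
        exact absurd h1 (by decide)
      omega, fun h => absurd h hS⟩⟩

/-- The point `0^∞ 1 0^n 1 0^∞` of a gap shift. -/
def twoPt {S : Set ℕ} (hS : S.Infinite) {n : ℕ} (hn : n ∈ S) : (gapShift S).carrier :=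
  ⟨fun j => if j = 0 ∨ j = n + 1 then 1 else 0, (mem_gapShift hS.nonempty).2
    ⟨fun g k h0 h1 _ => by
      have h0' : g = 0 ∨ g = n + 1 := by
        by_contra h
        rw [if_neg h] at h0
        exact absurd h0 (by decide)
      have h1' : g + k + 1 = 0 ∨ g + k + 1 = n + 1 := by
        by_contra h
        rw [if_neg h] at h1
        exact absurd h1 (by decide)
      have : k = n := by omega
      rwa [this], fun h => absurd h hS⟩⟩

@[simp] lemma zeroPt_apply {S : Set ℕ} (hS : S.Infinite) (j : ℤ) :
    (zeroPt hS : ℤ → Fin 2) j = 0 := rfl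

lemma onePt_zero {S : Set ℕ} (hS : S.Infinite) : (onePt hS : ℤ → Fin 2) 0 = 1 := rfl

lemma onePt_of_ne {S : Set ℕ} (hS : S.Infinite) {j : ℤ} (hj : j ≠ 0) :
    (onePt hS : ℤ → Fin 2) j = 0 := if_neg hj

@[simp] lemma sh_zeroPt {S : Set ℕ} (hS : S.Infinite) (j : ℤ) : sh j (zeroPt hS) = zeroPt hS :=
  ext_apply fun _ => rfl

lemma sh_onePt_ne_zeroPt {S : Set ℕ} (hS : S.Infinite) (j : ℤ) : sh j (onePt hS) ≠ zeroPt hS := by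
  intro h
  have h1 : (sh j (onePt hS) : ℤ → Fin 2) (-j) = 0 := by rw [h]; rfl
  rw [sh_apply, add_neg_cancel, onePt_zero] at h1
  exact absurd h1 (by decide)

/-- With `n` zeros between them the two `1`s are `n + 1` apart; the margin `1` keeps each copy from
seeing the `1` of the other. -/
lemma isGlued_twoPt {S : Set ℕ} (hS : S.Infinite) {n : ℕ} (hn : n ∈ S) :
    IsGlued (onePt hS : ℤ → Fin 2) (n + 1) 1 (twoPt hS hn) := by
  constructor
  · intro j hj
    exact if_congr (by omega) rfl rfl
  · intro j hj
    exact if_congr (by omega) rfl rfl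

/-- If `y` has a first and a last `1`, a point glued from `y` and a translate of `y` has a gap. -/
lemma exists_mem_of_isGlued {S : Set ℕ} (hS : S.Nonempty) {y : ℤ → Fin 2} {z : (gapShift S).carrier}
    {s e D J : ℤ} (hs : y s = 1) (he : y e = 1) (hlt : ∀ j, j < s → y j = 0)
    (hgt : ∀ j, e < j → y j = 0) (hz : IsGlued y D J z) (hJ : 2 * J ≤ D) (h1 : e ≤ D - J)
    (h2 : J ≤ s + D) (h3 : e < s + D) : ∃ m ∈ S, (m : ℤ) = s + D - e - 1 := by
  obtain ⟨m, hm⟩ := Int.eq_ofNat_of_zero_le (show 0 ≤ s + D - e - 1 by omega)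
  refine ⟨m, ((mem_gapShift hS).1 z.2).1 e m ?_ ?_ fun j hj hj' => ?_, hm.symm⟩
  · rw [hz.1 e h1, he]
  · rw [hz.2 _ (by omega), show e + m + 1 - D = s by omega, hs]
  · rcases le_or_gt j (D - J) with h | h
    · rw [hz.1 j h, hgt j hj]
    · rw [hz.2 j (by omega), hlt _ (by omega)]

end GapShift

/-! ### Minimal forms and eventual periods. -/

section EventuallyPeriodic

/-- The integers congruent modulo `N` to an element of `T`. -/
def residues (T : Finset ℕ) (N : ℕ) : Set ℤ := {z | ∃ t ∈ T, z ≡ t [ZMOD N]}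

lemma add_mul_mem_residues {T : Finset ℕ} {N : ℕ} {z : ℤ} (k : ℤ) :
    z + N * k ∈ residues T N ↔ z ∈ residues T N := by
  have : z + N * k ≡ z [ZMOD N] := by simp [Int.ModEq]
  exact exists_congr fun t => and_congr_right fun _ => ⟨this.symm.trans, this.trans⟩

namespace IsMinimalForm

variable {S : Set ℕ} {R T : Finset ℕ} {N : ℕ}

lemma mem_iff_of_le (h : IsMinimalForm S R T N) :
    ∃ K : ℕ, ∀ n : ℕ, K ≤ n → (n ∈ S ↔ (n : ℤ) ∈ residues T N) := by
  obtain ⟨K₁, hK₁⟩ := R.bddAbove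
  obtain ⟨K₂, hK₂⟩ := T.bddAbove
  refine ⟨max (K₁ + 1) K₂, fun n hn => ?_⟩
  rw [h.eq]
  constructor
  · rintro (hR | ⟨t, ht, k, rfl⟩)
    · have := hK₁ hR
      omega
    · exact ⟨t, ht, by simp [Int.ModEq]⟩
  · rintro ⟨t, ht, hmod⟩
    have hle : t ≤ n := (hK₂ ht).trans ((le_max_right _ _).trans hn)
    obtain ⟨k, hk⟩ := (Nat.modEq_iff_dvd' hle).1 (Int.natCast_modEq_iff.1 hmod).symm
    exact Or.inr ⟨t, ht, k, by omega⟩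

/-- The modulus of a minimal form is at most every eventual period. -/
lemma le_of_eventually (h : IsMinimalForm S R T N) {M : ℕ} (hM : 0 < M) {K : ℕ}
    (hK : ∀ n, K ≤ n → (n ∈ S ↔ n + M ∈ S)) : N ≤ M := by
  classical
  refine h.minimal ((Finset.range K).filter (· ∈ S)) ((Finset.Ico K (K + M)).filter (· ∈ S)) M hM ?_
  have hmul : ∀ n k, K ≤ n → (n ∈ S ↔ n + M * k ∈ S) := fun n k hn => by
    induction k with
    | zero => simp
    | succ k ih => rw [ih, hK _ (by omega)]; ring_nf
  ext n
  simp only [Set.mem_union, Finset.mem_coe, Finset.mem_filter, Finset.mem_range]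
  constructor
  · intro hn
    rcases lt_or_ge n K with hlt | hge
    · exact Or.inl ⟨hlt, hn⟩
    · have h1 : K + (n - K) % M + M * ((n - K) / M) = n := by
        have := Nat.mod_add_div (n - K) M
        omega
      refine Or.inr ⟨K + (n - K) % M, Finset.mem_filter.2 ⟨Finset.mem_Ico.2 ⟨by omega, ?_⟩, ?_⟩,
        (n - K) / M, h1.symm⟩
      · have := Nat.mod_lt (n - K) hM
        omega
      · rw [hmul _ ((n - K) / M) (by omega), h1]
        exact hn
  · rintro (⟨-, hn⟩ | ⟨t, ht, k, rfl⟩)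
    · exact hn
    · obtain ⟨ht, htS⟩ := Finset.mem_filter.1 ht
      exact (hmul t k (Finset.mem_Ico.1 ht).1).1 htS

lemma eq_one_of_cofinite (h : IsMinimalForm S R T N) {K : ℕ} (hK : ∀ n, K ≤ n → n ∈ S) : N = 1 :=
  le_antisymm (h.le_of_eventually one_pos (K := K)
    fun n hn => iff_of_true (hK n hn) (hK _ (by omega))) h.pos

lemma eq_one_of_finite (h : IsMinimalForm S R T N) (hS : S.Finite) : N = 1 := by
  obtain ⟨K, hK⟩ := hS.bddAbove
  refine le_antisymm (h.le_of_eventually one_pos (K := K + 1) fun n hn => iff_of_false ?_ ?_) h.pos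
  · intro hn'
    have := hK hn'
    omega
  · intro hn'
    have := hK hn'
    omega

lemma nonempty_iff_infinite (h : IsMinimalForm S R T N) : T.Nonempty ↔ S.Infinite := by
  constructor
  · rintro ⟨t, ht⟩
    refine (Set.infinite_range_of_injective (f := fun k : ℕ => t + N * k) fun a b hab => ?_).mono ?_
    · exact Nat.eq_of_mul_eq_mul_left h.pos (Nat.add_left_cancel hab)
    · rintro _ ⟨k, rfl⟩
      rw [h.eq]
      exact Or.inr ⟨t, ht, k, rfl⟩
  · intro hS
    by_contra hT
    rw [Finset.not_nonempty_iff_eq_empty] at hT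
    have : S = R := by rw [h.eq, hT]; simp [progressions]
    exact hS (this ▸ R.finite_toSet)

end IsMinimalForm

/-- If each of two eventually periodic sets is eventually contained in a translate of the other,
then they have the same minimal modulus and are eventually translates of each other. -/
theorem IsMinimalForm.eq_and_translate {S₁ S₂ : Set ℕ} {R₁ T₁ R₂ T₂ : Finset ℕ} {N M : ℕ}
    (h₁ : IsMinimalForm S₁ R₁ T₁ N) (h₂ : IsMinimalForm S₂ R₂ T₂ M) {c₁ c₂ : ℤ} {K₁ K₂ : ℕ}
    (hc₁ : ∀ n ∈ S₁, K₁ ≤ n → ∃ m ∈ S₂, (m : ℤ) = n + c₁)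
    (hc₂ : ∀ n ∈ S₂, K₂ ≤ n → ∃ m ∈ S₁, (m : ℤ) = n + c₂) :
    N = M ∧ ∃ r : ℤ, (fun t : ℕ => ((r + (t : ℤ) : ℤ) : ZMod N)) '' (T₁ : Set ℕ) =
      (fun t : ℕ => (t : ZMod N)) '' (T₂ : Set ℕ) := by
  have key : ∀ {S S' : Set ℕ} {R T R' T' : Finset ℕ} {N M : ℕ} (_ : IsMinimalForm S R T N)
      (_ : IsMinimalForm S' R' T' M) {c : ℤ} {K : ℕ}
      (_ : ∀ n ∈ S, K ≤ n → ∃ m ∈ S', (m : ℤ) = n + c) (z : ℤ), z ∈ residues T N →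
      z + c ∈ residues T' M := by
    intro S S' R T R' T' N M h h' c K hc z hz
    obtain ⟨L, hL⟩ := h.mem_iff_of_le
    obtain ⟨L', hL'⟩ := h'.mem_iff_of_le
    -- Adding `N * M * B` to `z` keeps its class for both moduli and passes all thresholds.
    set B : ℕ := z.natAbs + K + L + L' + c.natAbs with hB
    have hNM : (B : ℤ) ≤ N * M * B := by
      have : 1 ≤ N * M := Nat.mul_pos h.pos h'.pos
      exact_mod_cast Nat.le_mul_of_pos_left B this
    obtain ⟨n, hn⟩ := Int.eq_ofNat_of_zero_le (show 0 ≤ z + N * M * B by omega)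
    have hnS : n ∈ S := by
      rw [hL n (by omega), show ((n : ℕ) : ℤ) = z + N * (M * B) by rw [← mul_assoc]; exact hn.symm]
      exact (add_mul_mem_residues _).2 hz
    obtain ⟨m, hm, hmn⟩ := hc n hnS (by omega)
    rw [hL' m (by omega), hmn, show (n : ℤ) + c = z + c + M * (N * B) by
      rw [show (n : ℤ) = z + N * M * B from hn.symm]; ring, add_mul_mem_residues] at hm
    exact hm
  have k₁ := key h₁ h₂ hc₁
  have k₂ := key h₂ h₁ hc₂
  -- Going to `S₂` and back translates the residues into themselves; after `N` rounds the total
  -- translation is `0` modulo `N`, so inclusion becomes equality.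
  have hloop : ∀ z, z + (c₁ + c₂) ∈ residues T₁ N → z ∈ residues T₁ N := fun z hz => by
    have hmul : ∀ j : ℕ, z + (c₁ + c₂) * (j + 1) ∈ residues T₁ N := fun j => by
      induction j with
      | zero => simpa using hz
      | succ j ih =>
        have := k₂ _ (k₁ _ ih)
        push_cast
        convert this using 1
        ring
    have := hmul (N - 1)
    rw [show ((N - 1 : ℕ) : ℤ) + 1 = N by have := h₁.pos; omega, mul_comm,
      add_mul_mem_residues] at this
    exact this
  have hiff : ∀ z, z ∈ residues T₁ N ↔ z + c₁ ∈ residues T₂ M := fun z =>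
    ⟨k₁ z, fun hz => hloop z (by simpa [add_assoc] using k₂ _ hz)⟩
  have hNM : N ≤ M := by
    obtain ⟨L, hL⟩ := h₁.mem_iff_of_le
    refine h₁.le_of_eventually h₂.pos (K := L) fun n hn => ?_
    rw [hL n hn, hL _ (by omega), hiff, hiff, ← add_mul_mem_residues 1]
    push_cast
    ring_nf
  have hMN : M ≤ N := by
    obtain ⟨L, hL⟩ := h₂.mem_iff_of_le
    refine h₂.le_of_eventually h₁.pos (K := L) fun n hn => ?_
    have h3 := hiff (n - c₁)
    have h4 := hiff (n + N - c₁)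
    rw [sub_add_cancel] at h3 h4
    rw [hL n hn, hL _ (by omega), ← h3, Nat.cast_add, ← h4, ← add_mul_mem_residues 1]
    ring_nf
  obtain rfl : N = M := le_antisymm hNM hMN
  refine ⟨rfl, c₁, ?_⟩
  ext a
  constructor
  · rintro ⟨t, ht, rfl⟩
    obtain ⟨t', ht', hmod⟩ := (hiff t).1 ⟨t, ht, rfl⟩
    refine ⟨t', ht', ?_⟩
    have := (ZMod.intCast_eq_intCast_iff _ _ _).2 hmod
    change (t' : ZMod N) = ((c₁ + (t : ℤ) : ℤ) : ZMod N)
    rw [add_comm, this, Int.cast_natCast]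
  · rintro ⟨t', ht', rfl⟩
    obtain ⟨t, ht, hmod⟩ := (hiff (t' - c₁)).2 ⟨t', ht', by rw [sub_add_cancel]⟩
    refine ⟨t, ht, ?_⟩
    have := (ZMod.intCast_eq_intCast_iff _ _ _).2 hmod
    simp only [Int.cast_add, ← this]
    simp

/-- `ZMod 1` has one element, so only emptiness of the sets matters. -/
lemma exists_translate_of_eq_one {T₁ T₂ : Finset ℕ} (h : T₁.Nonempty ↔ T₂.Nonempty) :
    ∃ r : ℤ, (fun t : ℕ => ((r + (t : ℤ) : ℤ) : ZMod 1)) '' (T₁ : Set ℕ) =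
      (fun t : ℕ => (t : ZMod 1)) '' (T₂ : Set ℕ) := by
  refine ⟨0, ?_⟩
  rcases T₁.eq_empty_or_nonempty with h1 | h1
  · have h2 : T₂ = ∅ := Finset.not_nonempty_iff_eq_empty.1 fun h2 => by
      simp [h1] at h
      simp [h] at h2
    simp [h1, h2]
  · have h2 := h.1 h1
    rw [(Set.Nonempty.image _ (Finset.coe_nonempty.2 h1)).eq_univ,
      (Set.Nonempty.image _ (Finset.coe_nonempty.2 h2)).eq_univ]

end EventuallyPeriodic

/-! ### Transport of gaps, according to the image of `0^∞`. -/

section GapTransport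

variable {S₁ S₂ : Set ℕ}

lemma eq_add_mul_of_step {u : ℤ → ℤ} {k L I : ℤ} (h : ∀ i, I ≤ i → u (i + k) = u i + L)
    (hk : 0 ≤ k) {i : ℤ} (hi : I ≤ i) (n : ℕ) : u (i + k * n) = u i + L * n := by
  induction n with
  | zero => simp
  | succ n ih =>
    have h1 : 0 ≤ k * n := by positivity
    have := h (i + k * n) (by omega)
    push_cast
    rw [mul_add, mul_one, ← add_assoc, this, ih]
    ring

lemma exists_eq_add_of_step {u : ℤ → ℤ} {L I : ℤ} (h : ∀ i, I ≤ i → u (i + 1) = u i + L) :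
    ∃ a, ∀ i, I ≤ i → u i = L * i + a := by
  refine ⟨u I - L * I, fun i hi => ?_⟩
  obtain ⟨n, hn⟩ := Int.eq_ofNat_of_zero_le (show 0 ≤ i - I by omega)
  have := eq_add_mul_of_step h zero_le_one le_rfl n
  rw [one_mul, show I + (n : ℤ) = i by omega, show (n : ℤ) = i - I from hn.symm] at this
  rw [this]
  ring

/-- Far from its only `1`, the image of `0^∞ 1 0^∞` follows the image of `0^∞`. -/
lemma exists_asymptotic (hS : S₁.Infinite) {Y : Subshift (Fin 2) ℤ}
    (F : CocycleMap (gapShift S₁) Y) (hL : 0 < F.N (zeroPt hS) 1) :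
    ∃ I a b : ℤ, 0 ≤ I ∧
      (∀ i, I ≤ i → F.N (sh i (onePt hS)) 1 = F.N (zeroPt hS) 1) ∧
      (∀ i, i ≤ -I → F.N (sh i (onePt hS)) 1 = F.N (zeroPt hS) 1) ∧
      (∀ i, I ≤ i → F.N (onePt hS) i = F.N (zeroPt hS) 1 * i + a) ∧
      (∀ j, I ≤ j → (F.f (onePt hS) : ℤ → Fin 2) (j + a) = (F.f (zeroPt hS) : ℤ → Fin 2) j) ∧
      (∀ j, j ≤ -I → (F.f (onePt hS) : ℤ → Fin 2) (j + b) = (F.f (zeroPt hS) : ℤ → Fin 2) j) := by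
  set L := F.N (zeroPt hS) 1 with hLdef
  obtain ⟨C, R, hLC, hw⟩ := F.exists_isWindow L
  have hR := hw.nonneg_right
  have hagree : ∀ i : ℤ, R + 1 ≤ |i| → ∀ r, |r| ≤ R →
      (sh i (onePt hS) : ℤ → Fin 2) r = (zeroPt hS : ℤ → Fin 2) r := fun i hi r hr => by
    rw [sh_apply, onePt_of_ne]
    · rfl
    · rintro h
      have : |i| = |r| := by rw [← abs_neg, show -i = r by omega]
      omega
  have hN : ∀ i : ℤ, R + 1 ≤ |i| → F.N (sh i (onePt hS)) 1 = L := fun i hi =>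
    hw.N_eq _ _ (hagree i hi)
  have hNr : ∀ i, R + 1 ≤ i → F.N (sh i (onePt hS)) 1 = L := fun i hi => hN i (hi.trans (le_abs_self _))
  have hNl : ∀ i, i ≤ -(R + 1) → F.N (sh i (onePt hS)) 1 = L := fun i hi =>
    hN i (le_trans (by omega) (neg_le_abs i))
  obtain ⟨a, ha⟩ := exists_eq_add_of_step (u := F.N (onePt hS)) (L := L) (I := R + 1)
    fun i hi => by rw [F.N_add_one, hNr i hi]
  obtain ⟨b, hb⟩ := exists_eq_add_of_step (u := fun i => -F.N (onePt hS) (-i)) (L := L) (I := R + 1)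
    fun i hi => by
      have := F.N_add_one (onePt hS) (-(i + 1))
      rw [hNl _ (by omega), show -(i + 1) + 1 = -i by ring] at this
      omega
  have hper : ∀ (i r : ℤ), (F.f (zeroPt hS) : ℤ → Fin 2) (L * i + r) =
      (F.f (zeroPt hS) : ℤ → Fin 2) r := by
    have h1 : ∀ r, (F.f (zeroPt hS) : ℤ → Fin 2) (L + r) = (F.f (zeroPt hS) : ℤ → Fin 2) r :=
      fun r => by simpa using F.f_apply (zeroPt hS) 1 r
    intro i r
    induction i using Int.induction_on with
    | zero => simp
    | succ i ih => rw [show L * ((i : ℤ) + 1) + r = L + (L * i + r) by ring, h1, ih]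
    | pred i ih => rw [← h1, show L + (L * (-(i : ℤ) - 1) + r) = L * -i + r by ring, ih]
  have hy : ∀ (i : ℤ), R + 1 ≤ |i| → ∀ r, |r| ≤ C → (F.f (onePt hS) : ℤ → Fin 2)
      (F.N (onePt hS) i + r) = (F.f (zeroPt hS) : ℤ → Fin 2) r := fun i hi r hr => by
    rw [F.f_apply]
    exact hw.f_eq _ _ (hagree i hi) r hr
  have hmod : ∀ j, |j % L| ≤ C := fun j => by
    rw [abs_of_nonneg (Int.emod_nonneg _ hL.ne')]
    exact (Int.emod_lt_of_pos j hL).le.trans hLC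
  have hI : R + 1 ≤ L * (R + 2) := by nlinarith
  -- Write `j = L * (j / L) + j % L`: the time `j / L` is beyond the window radius, and the
  -- remainder is within `C` because `L ≤ C`. The sign of `b` comes from reversing time in `hb`.
  refine ⟨L * (R + 2), a, -b, by omega, fun i hi => hNr i (by omega), fun i hi => hNl i (by omega),
    fun i hi => ha i (by omega), fun j hj => ?_, fun j hj => ?_⟩
  · have hi : R + 1 ≤ j / L := by
      rw [Int.le_ediv_iff_mul_le hL]
      nlinarith
    have h1 := hy (j / L) (hi.trans (le_abs_self _)) (j % L) (hmod j)
    rw [ha _ hi, ← hper (j / L), Int.mul_ediv_add_emod] at h1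
    rw [← h1]
    refine congrArg _ ?_
    have := Int.mul_ediv_add_emod j L
    omega
  · have hi : j / L ≤ -(R + 1) := by
      have := Int.ediv_lt_of_lt_mul hL (show j < -(R + 1) * L by nlinarith)
      omega
    have h1 := hy (j / L) (le_trans (by omega) (neg_le_abs _)) (j % L) (hmod j)
    have h2 := hb (-(j / L)) (by omega)
    rw [neg_neg, mul_neg] at h2
    rw [show F.N (onePt hS) (j / L) = L * (j / L) - b by omega, ← hper (j / L),
      Int.mul_ediv_add_emod] at h1
    rw [← h1]
    refine congrArg _ ?_
    have := Int.mul_ediv_add_emod j L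
    omega

/-- A cocycle map that preserves `0^∞`, but does not send `0^∞ 1 0^∞` there, shifts the large gaps
by a constant. -/
theorem exists_add_mem_of_map_zeroPt (hS₁ : S₁.Infinite) (hS₂ : S₂.Infinite)
    (F : CocycleMap (gapShift S₁) (gapShift S₂)) (hf : F.f (zeroPt hS₁) = zeroPt hS₂)
    (hN : F.N (zeroPt hS₁) 1 = 1) (hone : F.f (onePt hS₁) ≠ zeroPt hS₂) :
    ∃ (c : ℤ) (K : ℕ), ∀ n ∈ S₁, K ≤ n → ∃ m ∈ S₂, (m : ℤ) = n + c := by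
  obtain ⟨I, a, b, -, hNr, hNl, ha, hyr, hyl⟩ := exists_asymptotic hS₁ F (by omega)
  rw [hN] at hNr hNl ha
  rw [hf] at hyr hyl
  set y := F.f (onePt hS₁)
  have hyr' : ∀ j, I + a ≤ j → (y : ℤ → Fin 2) j = 0 := fun j hj => by
    simpa using hyr (j - a) (by omega)
  have hyl' : ∀ j, j ≤ -I + b → (y : ℤ → Fin 2) j = 0 := fun j hj => by
    simpa using hyl (j - b) (by omega)
  have hex : ∃ j, (y : ℤ → Fin 2) j = 1 := by
    by_contra h
    push Not at h
    exact hone (ext_apply fun j => eq_zero_of_ne_one (h j))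
  obtain ⟨s, hs, hslt⟩ := Int.exists_least_of_bdd (P := fun j => (y : ℤ → Fin 2) j = 1)
    ⟨-I + b, fun j hj => by
      by_contra hlt
      rw [hyl' j (by omega)] at hj
      exact absurd hj (by decide)⟩ hex
  obtain ⟨e, he, hegt⟩ := Int.exists_greatest_of_bdd (P := fun j => (y : ℤ → Fin 2) j = 1)
    ⟨I + a, fun j hj => by
      by_contra hlt
      rw [hyr' j (by omega)] at hj
      exact absurd hj (by decide)⟩ hex
  obtain ⟨c, d, J, D₀, hglue⟩ := F.exists_isGlued (onePt hS₁) one_pos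
    (fun i hi => (hNl i hi).ge) (fun i hi => (hNr i hi).ge) 1
  -- The image displacement is `(n + 1 - c) + a + d`, and the new gap runs from the last `1` of the
  -- first copy to the first `1` of the second.
  refine ⟨1 - c + a + d + s - e - 1, (max D₀ (max (I + c) (max (2 * J + c - a - d)
    (max (e + J + c - a - d) (max (J - s + c - a - d) (e - s + c - a - d)))))).toNat,
    fun n hn hKn => ?_⟩
  have hg := hglue (n + 1) (by omega) _ (isGlued_twoPt hS₁ hn)
  rw [ha _ (by omega), one_mul] at hg
  obtain ⟨m, hm, hmn⟩ := exists_mem_of_isGlued hS₂.nonempty hs he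
    (fun j hj => eq_zero_of_ne_one fun h => by have := hslt j h; omega)
    (fun j hj => eq_zero_of_ne_one fun h => by have := hegt j h; omega) hg
    (by omega) (by omega) (by omega) (by omega)
  exact ⟨m, hm, by omega⟩

/-- If `0^∞` is sent to a point containing a `1`, then `S₁` is cofinite. -/
theorem cofinite_of_map_zeroPt (hS₁ : S₁.Infinite) (hS₂ : S₂.Nonempty)
    (F : CocycleMap (gapShift S₁) (gapShift S₂)) (G : CocycleMap (gapShift S₂) (gapShift S₁))
    (hGF : ∀ x, ∃ k, G.f (F.f x) = sh k x) (hL : 0 < F.N (zeroPt hS₁) 1)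
    (hGN : G.N (F.f (zeroPt hS₁)) (F.N (zeroPt hS₁) 1) = 1)
    (hone : ∃ j, (F.f (zeroPt hS₁) : ℤ → Fin 2) j = 1) : ∃ K : ℕ, ∀ n, K ≤ n → n ∈ S₁ := by
  obtain ⟨I, a, b, hI, -, -, -, hyr, hyl⟩ := exists_asymptotic hS₁ F hL
  obtain ⟨k₀, hk₀⟩ := hGF (onePt hS₁)
  have hperiod : sh (F.N (zeroPt hS₁) 1) (F.f (zeroPt hS₁)) = F.f (zeroPt hS₁) := by
    rw [← F.f_sh, sh_zeroPt]
  set y := F.f (onePt hS₁)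
  set q := F.f (zeroPt hS₁)
  set L := F.N (zeroPt hS₁) 1
  have hq : ∀ (n : ℕ) (j : ℤ), (q : ℤ → Fin 2) (j + L * n) = (q : ℤ → Fin 2) j := fun n j => by
    induction n with
    | zero => simp
    | succ n ih =>
      have h1 : (sh L q : ℤ → Fin 2) (j + L * n) = (q : ℤ → Fin 2) (j + L * n) := by rw [hperiod]
      rw [sh_apply, ih] at h1
      rw [← h1]
      refine congrArg _ ?_
      push_cast
      ring
  -- Compute the cocycle over `j + L` in both orders, using that `q` has period `L`.
  have hGq : ∀ j, G.N (sh j q) L = 1 := fun j => by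
    have h1 := G.N_add q j L
    have h2 := G.N_add q L j
    rw [hperiod, hGN] at h2
    rw [add_comm L j] at h2
    omega
  obtain ⟨R, hR, hwin⟩ := exists_window (G.continuous_N L)
  set I' := max (I + R + a) (I + R - b)
  have hGr : ∀ i, I' ≤ i → G.N (sh i y) L = 1 := fun i hi => by
    rw [← hGq (i - a)]
    refine hwin _ _ fun r hr => ?_
    rw [abs_le] at hr
    rw [sh_apply, sh_apply, ← hyr _ (by omega)]
    exact congrArg _ (by ring)
  have hGl : ∀ i, i ≤ -I' → G.N (sh i y) L = 1 := fun i hi => by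
    rw [← hGq (i - b)]
    refine hwin _ _ fun r hr => ?_
    rw [abs_le] at hr
    rw [sh_apply, sh_apply, ← hyl _ (by omega)]
    exact congrArg _ (by ring)
  obtain ⟨j₁, hj₁⟩ := hone
  -- Periodicity moves a `1` of `q` into the range where `y` follows `q`; this is where the copies
  -- will be glued.
  obtain ⟨t, htI, ht⟩ : ∃ t, I ≤ t ∧ (q : ℤ → Fin 2) t = 1 := by
    refine ⟨j₁ + L * (I - j₁).toNat, ?_, by rw [hq, hj₁]⟩
    have : 1 * ((I - j₁).toNat : ℤ) ≤ L * (I - j₁).toNat :=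
      mul_le_mul_of_nonneg_right hL (by positivity)
    omega
  set J := max (I - b) (t + a + 1)
  obtain ⟨c, d, J', D₀, hglue⟩ := G.exists_isGlued y hL (fun i hi => (hGl i hi).ge)
    (fun i hi => (hGr i hi).ge) J
  -- the displacement of the first admissible translate, and all the following ones
  obtain ⟨w₀, hw₀⟩ : ∃ w₀ : ℕ, max D₀ (max (I' + c) (I + t + a - b)) ≤ a - b + L * w₀ := by
    refine ⟨(max D₀ (max (I' + c) (I + t + a - b)) - (a - b)).toNat, ?_⟩
    have : 1 * ((max D₀ (max (I' + c) (I + t + a - b)) - (a - b)).toNat : ℤ) ≤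
        L * (max D₀ (max (I' + c) (I + t + a - b)) - (a - b)).toNat :=
      mul_le_mul_of_nonneg_right hL (by positivity)
    omega
  have hgap : ∀ w : ℕ, ∃ z : (gapShift S₁).carrier,
      IsGlued (sh k₀ (onePt hS₁) : ℤ → Fin 2) (G.N y (a - b + L * w₀ - c) + w + d) J' z := by
    intro w
    have hLw : 0 ≤ L * w := by positivity
    set D := a - b + L * (w₀ + w : ℕ) with hD
    have hDw : D = a - b + L * w₀ + L * w := by rw [hD]; push_cast; ring
    -- On the overlap both copies follow `q`, with phases `a` and `b + D`, which are congruent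
    -- modulo `L` by the choice of `D`.
    have hover : ∀ j, I + a ≤ j → j ≤ b + D - I →
        (y : ℤ → Fin 2) (j - D) = (y : ℤ → Fin 2) j := fun j hj hj' => by
      have h1 := hyr (j - a) (by omega)
      have h2 := hyl (j - D - b) (by omega)
      rw [sub_add_cancel] at h1 h2
      rw [h1, h2, ← hq (w₀ + w)]
      exact congrArg _ (by omega)
    have hyt : (y : ℤ → Fin 2) (t + a) = 1 := by rw [hyr t htI, ht]
    have hyt' : (sh (-D) y : ℤ → Fin 2) (t + a) = 1 := by
      rw [sh_apply, ← hyt, ← hover (t + a) (by omega) (by omega)]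
      exact congrArg _ (by ring)
    have hz := glue_mem_gapShift hS₂ y.2 (sh (-D) y).2 hyt hyt'
    have hg := hglue D (by omega) ⟨_, hz⟩ ⟨fun j hj => ?_, fun j hj => ?_⟩
    · have hDc : G.N y (D - c) = G.N y (a - b + L * w₀ - c) + w := by
        rw [hDw, show a - b + L * w₀ + L * w - c = a - b + L * w₀ - c + L * w by ring,
          eq_add_mul_of_step (u := G.N y) (L := 1) (I := I') (fun i hi => by rw [G.N_add, hGr i hi])
            hL.le (by omega), one_mul]
      rw [hk₀, hDc] at hg
      exact ⟨_, hg⟩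
    · dsimp only
      split_ifs with h
      · rfl
      · rw [sh_apply, ← hover j (by omega) (by omega)]
        exact congrArg _ (by ring)
    · dsimp only
      rw [if_neg (by omega), sh_apply]
      exact congrArg _ (by ring)
  set e := G.N y (a - b + L * w₀ - c) + d
  refine ⟨(max e (max (2 * J') (max (J' - k₀) (J' + k₀)))).toNat, fun n hn => ?_⟩
  -- Choose `w` so that the displacement `e + w` is `n + 1`: the two single `1`s then enclose a gap
  -- of length `n`.
  obtain ⟨w, hw⟩ := Int.eq_ofNat_of_zero_le (show 0 ≤ n + 1 - e by omega)
  obtain ⟨z, hz⟩ := hgap w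
  have hp : (sh k₀ (onePt hS₁) : ℤ → Fin 2) (-k₀) = 1 := by
    rw [sh_apply, add_neg_cancel, onePt_zero]
  have hp' : ∀ j, j ≠ -k₀ → (sh k₀ (onePt hS₁) : ℤ → Fin 2) j = 0 := fun j hj => by
    rw [sh_apply, onePt_of_ne]
    omega
  obtain ⟨m, hm, hmn⟩ := exists_mem_of_isGlued hS₁.nonempty hp hp (fun j hj => hp' j hj.ne)
    (fun j hj => hp' j hj.ne') hz (by omega) (by omega) (by omega) (by omega)
  rwa [show n = m by omega]

lemma CocycleMap.N_fixed {A B : Type*} [TopologicalSpace A] [TopologicalSpace B]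
    {X : Subshift A ℤ} {Y : Subshift B ℤ} (F : CocycleMap X Y) {p : X.carrier}
    (hp : ∀ j, sh j p = p) (j : ℤ) : F.N p j = j * F.N p 1 := by
  induction j using Int.induction_on with
  | zero => simp
  | succ i ih => rw [F.N_add_one, hp, ih]; ring
  | pred i ih =>
    have := F.N_add_one p (-i - 1)
    rw [hp, sub_add_cancel, ih] at this
    linarith

end GapTransport

end FlowEq

theorem mainTheorem3 (S₁ S₂ : Set ℕ) (hS₁ : S₁.Nonempty) (hS₂ : S₂.Nonempty)
    (hsofic₁ : FlowEq.IsSofic (FlowEq.gapShift S₁)) (hsofic₂ : FlowEq.IsSofic (FlowEq.gapShift S₂))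
    (R₁ T₁ R₂ T₂ : Finset ℕ) (N M : ℕ)
    (hmin₁ : FlowEq.IsMinimalForm S₁ R₁ T₁ N) (hmin₂ : FlowEq.IsMinimalForm S₂ R₂ T₂ M)
    (hFE : FlowEq.FlowEquivalent (FlowEq.gapShift S₁) (FlowEq.gapShift S₂)) :
    N = M ∧
      ((S₁.Infinite ↔ S₂.Infinite) →
        ∃ r : ℤ, (fun t : ℕ => ((r + (t : ℤ) : ℤ) : ZMod N)) '' (T₁ : Set ℕ) =
          (fun t : ℕ => (t : ZMod N)) '' (T₂ : Set ℕ)) := by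
  obtain ⟨F, G, hGF, hFG, hF, hG⟩ := hFE.exists_cocycleMaps
  have hone : ∀ {S : Set ℕ} (hS : S.Nonempty) (y : (FlowEq.gapShift S).carrier),
      (∀ hi : S.Infinite, y ≠ FlowEq.zeroPt hi) → ∃ j, (y : ℤ → Fin 2) j = 1 := by
    intro S hS y hy
    by_cases hi : S.Infinite
    · by_contra h
      push Not at h
      exact hy hi (FlowEq.ext_apply fun j => FlowEq.eq_zero_of_ne_one (h j))
    · obtain ⟨j, -, -, hj⟩ := ((FlowEq.mem_gapShift hS).1 y.2).2 (Set.not_infinite.1 hi) 0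
      exact ⟨j, hj⟩
  have trivialCase : N = 1 → M = 1 → N = M ∧ ((S₁.Infinite ↔ S₂.Infinite) →
        ∃ r : ℤ, (fun t : ℕ => ((r + (t : ℤ) : ℤ) : ZMod N)) '' (T₁ : Set ℕ) =
          (fun t : ℕ => (t : ZMod N)) '' (T₂ : Set ℕ)) := by
    rintro rfl rfl
    exact ⟨rfl, fun h => FlowEq.exists_translate_of_eq_one
      (by rw [hmin₁.nonempty_iff_infinite, hmin₂.nonempty_iff_infinite, h])⟩
  -- This alternative is symmetric in `F` and `G`, since their composites fix `0^∞`.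
  by_cases hzero : ∃ (h₁ : S₁.Infinite) (h₂ : S₂.Infinite),
      F.f (FlowEq.zeroPt h₁) = FlowEq.zeroPt h₂
  · obtain ⟨h₁, h₂, hf⟩ := hzero
    obtain ⟨hF0, hFG1⟩ := hF _ (FlowEq.sh_zeroPt h₁ 1)
    have hg : G.f (FlowEq.zeroPt h₂) = FlowEq.zeroPt h₁ := by
      obtain ⟨k, hk⟩ := hGF (FlowEq.zeroPt h₁)
      rwa [hf, FlowEq.sh_zeroPt] at hk
    rw [hf, G.N_fixed (FlowEq.sh_zeroPt h₂)] at hFG1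
    -- The two cocycles at `0^∞` multiply to `1`, and this one is positive.
    have hFN : F.N (FlowEq.zeroPt h₁) 1 = 1 := Int.eq_one_of_mul_eq_one_right hF0.le hFG1
    have hGN : G.N (FlowEq.zeroPt h₂) 1 = 1 := by rwa [hFN, one_mul] at hFG1
    obtain ⟨c₁, K₁, hc₁⟩ := FlowEq.exists_add_mem_of_map_zeroPt h₁ h₂ F hf hFN fun h => by
      obtain ⟨k, hk⟩ := hGF (FlowEq.onePt h₁)
      rw [h, hg] at hk
      exact FlowEq.sh_onePt_ne_zeroPt h₁ k hk.symm
    obtain ⟨c₂, K₂, hc₂⟩ := FlowEq.exists_add_mem_of_map_zeroPt h₂ h₁ G hg hGN fun h => by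
      obtain ⟨k, hk⟩ := hFG (FlowEq.onePt h₂)
      rw [h, hf] at hk
      exact FlowEq.sh_onePt_ne_zeroPt h₂ k hk.symm
    obtain ⟨hNM, hr⟩ := hmin₁.eq_and_translate hmin₂ hc₁ hc₂
    exact ⟨hNM, fun _ => hr⟩
  · refine trivialCase ?_ ?_
    · by_cases h₁ : S₁.Infinite
      · obtain ⟨hL, hGN⟩ := hF _ (FlowEq.sh_zeroPt h₁ 1)
        obtain ⟨K, hK⟩ := FlowEq.cofinite_of_map_zeroPt h₁ hS₂ F G hGF hL hGN
          (hone hS₂ _ fun h₂ h => hzero ⟨h₁, h₂, h⟩)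
        exact hmin₁.eq_one_of_cofinite hK
      · exact hmin₁.eq_one_of_finite (Set.not_infinite.1 h₁)
    · by_cases h₂ : S₂.Infinite
      · obtain ⟨hL, hFN⟩ := hG _ (FlowEq.sh_zeroPt h₂ 1)
        obtain ⟨K, hK⟩ := FlowEq.cofinite_of_map_zeroPt h₂ hS₁ G F hFG hL hFN
          (hone hS₁ _ fun h₁ h => hzero ⟨h₁, h₂, by
            obtain ⟨k, hk⟩ := hFG (FlowEq.zeroPt h₂)
            rwa [h, FlowEq.sh_zeroPt] at hk⟩)
        exact hmin₂.eq_one_of_cofinite hK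
      · exact hmin₂.eq_one_of_finite (Set.not_infinite.1 h₂)
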